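/- Let $r\ge 1$. A local potential of range $r$ is a function $S:\mathbb{R}^{r+1}\to\mathbb{R}$ satisfying the following conditions. A. $S(x_0+1,\dots,x_r+1)=S(x_0,\dots,x_r)$. B. $S$ is $C^2$, $\partial_{i}\partial_{k}S\le 0$ everywhere for all $i\ne k$, and $\partial_0\partial_1S<0$ everywhere. C. $S$ is bounded below, and there is $0\le k\le r-1$ such that $S(x_0,\dots,x_r)\to\infty$ as $|x_{k+1}-x_k|\to\infty$ (uniformly in the other variables). For $x:\mathbb{Z}\to\mathbb{R}$ and integers $i_0,i_1$ put $W_{[i_0,i_1]}(x)=\sum_{j=i_0}^{i_1}S(x_j,\dots,x_{j+r})$. The sequence $x$ is a global minimizer for $S$ if $W_{[i_0,i_1]}(x)\le W_{[i_0,i_1]}(x+v)$ for all $i_0,i_1$ and all $v:\mathbb{Z}\to\mathbb{R}$ supported in $[i_0+r,i_1]$. It is Birkhoff if the family of its translates $(\tau_{k,l}x)_i=x_{i-k}+l$, $k,l\in\mathbb{Z}$, is totally ordered by the coordinatewise order; its rotation number is then the unique $\omega\in\mathbb{R}$ with $|x_i-(x_0+\omega i)|\le 1$ for all $i\in\mathbb{Z}$.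 Let $\mathcal{M}_\omega(S)$ be the set of Birkhoff global minimizers for $S$ of rotation number $\omega$. For integers $p>0$ and $q$ let $\mathcal{M}_{p,q}(S)$ be the set of minimizers of $W_{[0,p-1]}$ over $\{x:\mathbb{Z}\to\mathbb{R}\mid\tau_{p,q}x=x\}$. A set $\mathcal{M}$ of sequences is a foliation if for every $\xi\in\mathbb{R}$ there is $x\in\mathcal{M}$ with $x_0=\xi$; otherwise it is called a lamination. For $K>0$ let $X_K=\{x:\mathbb{Z}\to\mathbb{R}\mid |x_{i+1}-x_i|\le K\text{ for all }i\in\mathbb{Z}\}$ and, for $f:\mathbb{R}^{r+1}\to\mathbb{R}$, put $\|f\|_{C^0(X_K)}=\sup_{x\in X_K}|f(x_0,\dots,x_r)|$ and, for differentiable $f$, $\|f\|_{C^1(X_K)}=\max\bigl(\|f\|_{C^0(X_K)},\max_{0\le k\le r}\|\partial_kf\|_{C^0(X_K)}\bigr)$. **Theorem.** Let $\omega\in\mathbb{R}$ and let $S$ be a local potential of range $r$ (satisfying A–C). (1) If $\mathcal{M}_\omega(S)$ is not a foliation, then there are $\delta>0$ and $K>0$ such that for every local potential $S^\delta$ of range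 $r$ (satisfying A–C) with $\|S^\delta-S\|_{C^0(X_K)}<\delta$ and $\|S^\delta-S\|_{C^1(X_K)}\le 1$, the set $\mathcal{M}_\omega(S^\delta)$ is not a foliation. (2) If $\omega=q/p$ is rational, with integers $p>0$ and $q$, then the same holds with $\mathcal{M}_{p,q}(S)$ and $\mathcal{M}_{p,q}(S^\delta)$ in place of $\mathcal{M}_\omega(S)$ and $\mathcal{M}_\omega(S^\delta)$. (3) Having a lamination of irrational rotation number is an open property: if $\omega$ is irrational and $\mathcal{M}_\omega(S)$ is not a foliation, then there are $\eta>0$ and $K>0$ such that $\mathcal{M}_\omega(S')$ is not a foliation for every local potential $S'$ of range $r$ (satisfying A–C) with $\|S'-S\|_{C^1(X_K)}<\eta$. -/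

import Mathlib

namespace AubryMather

/-- The first-order partial derivative `∂_k f` of a function of `x_0, …, x_r`. -/
noncomputable def pderiv {r : ℕ} (k : Fin (r + 1)) (f : (Fin (r + 1) → ℝ) → ℝ) :
    (Fin (r + 1) → ℝ) → ℝ :=
  fun x => fderiv ℝ f x (Pi.single k 1)

/-- The conditions A (periodicity), B (monotonicity, twist) and C (coercivity) on a local
potential `S : ℝ^{r+1} → ℝ` with range of interaction `r`. -/
structure IsLocalPotential {r : ℕ} (S : (Fin (r + 1) → ℝ) → ℝ) : Prop where
  periodic : ∀ x, S (fun i => x i + 1) = S x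
  contDiff : ContDiff ℝ 2 S
  mixed_nonpos : ∀ i k, i ≠ k → ∀ x, pderiv i (pderiv k S) x ≤ 0
  twist : ∀ x, pderiv 0 (pderiv 1 S) x < 0
  bddBelow : BddBelow (Set.range S)
  /-- `S(x) → ∞` as `|x_{k+1} - x_k| → ∞`, uniformly in `x`, for some `0 ≤ k ≤ r - 1`. -/
  coercive : ∃ k : Fin r, Filter.Tendsto S
    (Filter.comap (fun x : Fin (r + 1) → ℝ => |x k.succ - x k.castSucc|) Filter.atTop)
    Filter.atTop

/-- The window `(x_j, …, x_{j+r})` of a bi-infinite sequence. -/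
def window (r : ℕ) (x : ℤ → ℝ) (j : ℤ) : Fin (r + 1) → ℝ :=
  fun k => x (j + ((k : ℕ) : ℤ))

/-- The finite action `W_{[i₀, i₁]}(x) = ∑_{j ∈ [i₀, i₁]} S(x_j, …, x_{j+r})`. -/
noncomputable def action {r : ℕ} (S : (Fin (r + 1) → ℝ) → ℝ) (i₀ i₁ : ℤ) (x : ℤ → ℝ) : ℝ :=
  ∑ j ∈ Finset.Icc i₀ i₁, S (window r x j)

/-- Global minimizers: no variation supported in `[i₀ + r, i₁]` lowers `W_{[i₀, i₁]}`. -/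
def IsGlobalMinimizer {r : ℕ} (S : (Fin (r + 1) → ℝ) → ℝ) (x : ℤ → ℝ) : Prop :=
  ∀ i₀ i₁ : ℤ, ∀ v : ℤ → ℝ, Function.support v ⊆ Set.Icc (i₀ + (r : ℤ)) i₁ →
    action S i₀ i₁ x ≤ action S i₀ i₁ (x + v)

/-- The translate `(τ_{k,l} x)_i = x_{i-k} + l`. -/
def translate (k l : ℤ) (x : ℤ → ℝ) : ℤ → ℝ :=
  fun i => x (i - k) + (l : ℝ)

/-- Birkhoff sequences: the integer translates are totally ordered for the
coordinatewise order. -/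
def IsBirkhoff (x : ℤ → ℝ) : Prop :=
  IsChain (· ≤ ·) {y : ℤ → ℝ | ∃ k l : ℤ, y = translate k l x}

/-- `ω` is the rotation number of the Birkhoff sequence `x`: the (unique) real number
with `|x_i - (x_0 + ω i)| ≤ 1` for all `i`. -/
def HasRotationNumber (x : ℤ → ℝ) (ω : ℝ) : Prop :=
  ∀ i : ℤ, |x i - (x 0 + ω * (i : ℝ))| ≤ 1

/-- The set `M_ω` of Birkhoff global minimizers of rotation number `ω`. -/
def minimizers {r : ℕ} (S : (Fin (r + 1) → ℝ) → ℝ) (ω : ℝ) : Set (ℤ → ℝ) :=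
  {x | IsBirkhoff x ∧ HasRotationNumber x ω ∧ IsGlobalMinimizer S x}

/-- The space `X_{p,q}` of `(p,q)`-periodic sequences. -/
def periodicSeq (p q : ℤ) : Set (ℤ → ℝ) :=
  {x | translate p q x = x}

/-- The set `M_{p,q}` of `(p,q)`-periodic minimizers (used for `p > 0`): the minimizers of
`W_{p,q} = W_{[0, p-1]}` over `X_{p,q}`. -/
def periodicMinimizers {r : ℕ} (S : (Fin (r + 1) → ℝ) → ℝ) (p q : ℤ) : Set (ℤ → ℝ) :=
  {x | x ∈ periodicSeq p q ∧
    ∀ y ∈ periodicSeq p q, action S 0 (p - 1) x ≤ action S 0 (p - 1) y}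

/-- A collection of sequences is a foliation if it attains every initial value; a collection
of minimizers that is not a foliation is called a lamination. -/
def IsFoliation (M : Set (ℤ → ℝ)) : Prop :=
  ∀ ξ : ℝ, ∃ x ∈ M, x 0 = ξ

/-- `X_K`: sequences with increments bounded by `K`. -/
def boundedIncr (K : ℝ) : Set (ℤ → ℝ) :=
  {x | ∀ i : ℤ, |x (i + 1) - x i| ≤ K}

/-- `‖f‖_{C^0(X_K)} = sup_{x ∈ X_K} |f(x_0, …, x_r)|`, as an extended nonnegative real. -/
noncomputable def c0Norm {r : ℕ} (K : ℝ) (f : (Fin (r + 1) → ℝ) → ℝ) : ENNReal :=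
  ⨆ x ∈ boundedIncr K, ENNReal.ofReal |f (window r x 0)|

/-- `‖f‖_{C^1(X_K)}`: the largest of the `C^0(X_K)` norms of `f` and of its first-order
partial derivatives. -/
noncomputable def c1Norm {r : ℕ} (K : ℝ) (f : (Fin (r + 1) → ℝ) → ℝ) : ENNReal :=
  max (c0Norm K f) (⨆ k : Fin (r + 1), c0Norm K (pderiv k f))

end AubryMather

/-!
A foliation is a closed condition, and the proof shows this by compactness. Suppose potentials
`S_n` converge to `S` uniformly on `X_K` and the minimizers of each `S_n` form a foliation. For a
given `ξ`, minimizers `x_n` of `S_n` with `(x_n)_0 = ξ` that stay at bounded distance from the line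
`ξ + ω i` have a pointwise limit `x` with `x_0 = ξ`, and `x` turns out to be a minimizer of `S`. So
the minimizers of `S` form a foliation too, and the robustness of laminations is the contrapositive.

Two points need care, since `S_n` is controlled only on a fixed `X_K`.

* The inequality `W(x_n) ≤ W(x_n + v)` passes to the limit only if `x_n + v` stays in `X_K`, hence
  for small variations `v`. That is enough (`le_apply_add_of_bounded`): the action is submodular,
  because the mixed derivatives are nonpositive (`IsLocalPotential.inf_add_sup_le`), and invariant
  under adding `1`, and this makes minimality against variations of size at most `1` imply
  minimality against all variations.
* A Birkhoff sequence of rotation number `ω` has increments bounded by `|ω| + 2`, but a periodic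
  minimizer comes with no such bound that is independent of the potential. By submodularity
  periodic minimizers form a lattice, invariant under translations; lattice operations on
  translates turn a given one into one close to a line of slope `q / p` with the same value
  at `0` (`exists_mem_periodicMinimizers_apply_zero`).
-/

open Filter Topology

namespace AubryMather

/-! ### Submodularity of the action -/

theorem le_of_fderiv_apply_nonpos {E : Type*} [NormedAddCommGroup E] [NormedSpace ℝ E]
    {f : E → ℝ} (hf : Differentiable ℝ f) {v : E} (h : ∀ x, fderiv ℝ f x v ≤ 0) (x : E) :
    f (x + v) ≤ f x := by
  have hd : ∀ t : ℝ, HasDerivAt (fun t : ℝ => f (x + t • v)) (fderiv ℝ f (x + t • v) v) t := by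
    intro t
    have h1 : HasDerivAt (fun t : ℝ => x + t • v) v t := by
      simpa using ((hasDerivAt_id t).smul_const v).const_add x
    exact (hf _).hasFDerivAt.comp_hasDerivAt t h1
  have := antitone_of_hasDerivAt_nonpos hd (fun t => h _) (zero_le_one' ℝ)
  simpa using this

theorem fderiv_apply_eq_sum_pderiv {r : ℕ} (f : (Fin (r + 1) → ℝ) → ℝ)
    (x u : Fin (r + 1) → ℝ) : fderiv ℝ f x u = ∑ k, u k * pderiv k f x := by
  conv_lhs => rw [pi_eq_sum_univ' u]
  simp [pderiv, map_sum]

section Submodularity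

variable {r : ℕ} {S : (Fin (r + 1) → ℝ) → ℝ}

theorem IsLocalPotential.fderiv_add_le (hS : IsLocalPotential S) {u v : Fin (r + 1) → ℝ}
    (hu : 0 ≤ u) (hv : 0 ≤ v) (huv : ∀ i, u i * v i = 0) (x : Fin (r + 1) → ℝ) :
    fderiv ℝ S (x + v) u ≤ fderiv ℝ S x u := by
  have hd : ∀ k, Differentiable ℝ (pderiv k S) := fun k =>
    ((hS.contDiff.fderiv_right (m := 1) (by norm_num)).clm_apply
      contDiff_const).differentiable (by norm_num)
  have key := fun k => fderiv_apply_eq_sum_pderiv (pderiv k S)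
  simp only [fderiv_apply_eq_sum_pderiv S]
  refine le_of_fderiv_apply_nonpos (f := fun y => ∑ k, u k * pderiv k S y)
    (Differentiable.fun_sum fun k _ => (hd k).const_mul _) (fun y => ?_) x
  have h1 : HasFDerivAt (fun y => ∑ k, u k * pderiv k S y)
      (∑ k, u k • fderiv ℝ (pderiv k S) y) y :=
    HasFDerivAt.fun_sum fun k _ => ((hd k y).hasFDerivAt.const_mul (u k))
  rw [h1.fderiv, sum_apply]
  refine Finset.sum_nonpos fun k _ => ?_
  rw [smul_apply, key, smul_eq_mul, Finset.mul_sum]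
  refine Finset.sum_nonpos fun i _ => ?_
  rcases eq_or_ne i k with rfl | hik
  · rw [← mul_assoc, huv, zero_mul]
  · exact mul_nonpos_of_nonneg_of_nonpos (hu k)
      (mul_nonpos_of_nonneg_of_nonpos (hv i) (hS.mixed_nonpos i k hik y))

/-- The sign of the mixed derivatives makes `S` submodular on the lattice `ℝ^{r+1}`. -/
theorem IsLocalPotential.inf_add_sup_le (hS : IsLocalPotential S) (a b : Fin (r + 1) → ℝ) :
    S (a ⊓ b) + S (a ⊔ b) ≤ S a + S b := by
  have hd : Differentiable ℝ S := hS.contDiff.differentiable (by norm_num)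
  set m := a ⊓ b with hm
  have hmi : ∀ i, m i = min (a i) (b i) := fun i => rfl
  have hua : 0 ≤ a - m := sub_nonneg.2 inf_le_left
  have hub : 0 ≤ b - m := sub_nonneg.2 inf_le_right
  have huv : ∀ i, (a - m) i * (b - m) i = 0 := by
    intro i
    simp only [Pi.sub_apply, hmi]
    rcases le_total (a i) (b i) with h | h <;> simp [h]
  have hd' : Differentiable ℝ fun y => S (y + (b - m)) :=
    hd.comp (differentiable_id.add_const _)
  have := le_of_fderiv_apply_nonpos (f := fun y => S (y + (b - m)) - S y) (v := a - m)
    (hd'.sub hd) (fun y => by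
      rw [fderiv_fun_sub (hd' y) (hd y), fderiv_comp_add_right]
      exact sub_nonpos.2 (hS.fderiv_add_le hua hub huv y)) m
  have e1 : m + (a - m) + (b - m) = a ⊔ b := by
    rw [← add_right_inj (a ⊓ b), inf_add_sup, ← hm]; abel
  have e2 : m + (a - m) = a := by abel
  have e3 : m + (b - m) = b := by abel
  beta_reduce at this
  rw [e1, e2, e3] at this
  linarith

theorem IsLocalPotential.action_inf_add_sup_le (hS : IsLocalPotential S) (i₀ i₁ : ℤ)
    (x y : ℤ → ℝ) :
    action S i₀ i₁ (x ⊓ y) + action S i₀ i₁ (x ⊔ y) ≤ action S i₀ i₁ x + action S i₀ i₁ y := by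
  simp only [action, ← Finset.sum_add_distrib]
  exact Finset.sum_le_sum fun j _ => hS.inf_add_sup_le (window r x j) (window r y j)

theorem IsLocalPotential.apply_add_int (hS : IsLocalPotential S) (l : ℤ)
    (x : Fin (r + 1) → ℝ) : S (fun i => x i + l) = S x := by
  induction l using Int.induction_on with
  | zero => simp
  | succ n ih => rw [← ih, ← hS.periodic fun i => x i + (n : ℤ)]; push_cast; simp only [add_assoc]
  | pred n ih => rw [← ih, ← hS.periodic]; push_cast; congr 1; ext i; ring

theorem IsLocalPotential.action_add_int (hS : IsLocalPotential S) (i₀ i₁ l : ℤ)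
    (x : ℤ → ℝ) : action S i₀ i₁ (fun i => x i + l) = action S i₀ i₁ x :=
  Finset.sum_congr rfl fun j _ => hS.apply_add_int l (window r x j)

end Submodularity

/-! ### From small variations to bounded variations -/

/-- If `F` is submodular and invariant under adding `1`, minimality of `x` against variations of
size at most `1` implies minimality against all bounded variations: by induction on the size of
`v`, replacing `x + v` by its truncation between `x - 1` and `x + 1` does not increase `F`, since
what is cut off is a smaller variation of `x ± 1`. -/
theorem le_apply_add_of_bounded {F : (ℤ → ℝ) → ℝ}
    (hF : ∀ x y, F (x ⊓ y) + F (x ⊔ y) ≤ F x + F y)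
    (hF1 : ∀ x : ℤ → ℝ, F (fun i => x i + 1) = F x)
    {V : Set (ℤ → ℝ)} (hV : ∀ v ∈ V, ∀ φ : ℝ → ℝ, φ 0 = 0 → (fun i => φ (v i)) ∈ V)
    {x : ℤ → ℝ} (hx : ∀ v ∈ V, (∀ i, |v i| ≤ 1) → F x ≤ F (x + v)) (N : ℕ) :
    ∀ v ∈ V, (∀ i, |v i| ≤ N + 1) → F x ≤ F (x + v) := by
  induction N with
  | zero => simpa using hx
  | succ n ih =>
    intro v hv hb
    push_cast at hb
    have hF1' : ∀ x : ℤ → ℝ, F (fun i => x i - 1) = F x := fun x => by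
      rw [← hF1]; simp
    have hn : (0 : ℝ) ≤ n := n.cast_nonneg
    have up := hF (x + v) (fun i => x i + 1)
    have up1 : (x + v) ⊓ (fun i => x i + 1) = x + fun i => min (v i) 1 := by
      ext i; simp [min_add_add_left]
    have up2 : (x + v) ⊔ (fun i => x i + 1)
        = fun i => (x + fun i => max (v i - 1) 0) i + 1 := by
      ext i
      simp only [Pi.sup_apply, Pi.add_apply]
      rw [add_assoc, ← max_add_add_right, ← max_add_add_left]; simp
    have up3 := ih (fun i => max (v i - 1) 0) (hV v hv (fun t => max (t - 1) 0) (by simp))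
      (fun i => by
        have := abs_le.1 (hb i)
        rw [abs_le]; constructor
        · have := le_max_right (v i - 1) 0; linarith
        · exact max_le (by linarith) (by linarith))
    rw [up1, up2, hF1, hF1] at up
    have lo := hF (x + fun i => min (v i) 1) (fun i => x i - 1)
    have lo1 : (x + fun i => min (v i) 1) ⊔ (fun i => x i - 1)
        = x + fun i => max (min (v i) 1) (-1) := by
      ext i
      simp only [Pi.sup_apply, Pi.add_apply]
      rw [sub_eq_add_neg, max_add_add_left]
    have lo2 : (x + fun i => min (v i) 1) ⊓ (fun i => x i - 1)
        = fun i => (x + fun i => min (min (v i) 1 + 1) 0) i - 1 := by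
      ext i
      simp only [Pi.inf_apply, Pi.add_apply]
      rw [sub_eq_add_neg, sub_eq_add_neg, min_add_add_left, add_assoc, ← min_add_add_right]; simp
    have lo3 := ih (fun i => min (min (v i) 1 + 1) 0)
      (hV v hv (fun t => min (min t 1 + 1) 0) (by norm_num))
      (fun i => by
        have := abs_le.1 (hb i)
        rw [abs_le]; constructor
        · refine le_min ?_ (by linarith)
          have : -((n : ℝ) + 1 + 1) ≤ min (v i) 1 := le_min (by linarith) (by linarith)
          linarith
        · have := min_le_right (min (v i) 1 + 1) 0; linarith)
    rw [lo1, lo2, hF1', hF1'] at lo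
    have fin := hx (fun i => max (min (v i) 1) (-1))
      (hV v hv (fun t => max (min t 1) (-1)) (by norm_num))
      (fun i => abs_le.2 ⟨le_max_right _ _, max_le (min_le_right _ _) (by norm_num)⟩)
    linarith

/-! ### Limits of actions -/

section Convergence

variable {r : ℕ}

theorem abs_window_le_of_c0Norm_lt {K δ : ℝ} {f : (Fin (r + 1) → ℝ) → ℝ}
    (h : c0Norm K f < ENNReal.ofReal δ) {x : ℤ → ℝ} (hx : x ∈ boundedIncr K) (j : ℤ) :
    |f (window r x j)| ≤ δ := by
  have hδ : 0 < δ := ENNReal.ofReal_pos.1 (bot_le.trans_lt h)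
  have hs : (fun i => x (j + i)) ∈ boundedIncr K := fun i => by
    simpa [add_assoc] using hx (j + i)
  have h1 : ENNReal.ofReal |f (window r (fun i => x (j + i)) 0)| ≤ c0Norm K f :=
    le_iSup₂ (f := fun (x : ℤ → ℝ) (_ : x ∈ boundedIncr K) =>
      ENNReal.ofReal |f (window r x 0)|) _ hs
  have h2 : window r (fun i => x (j + i)) 0 = window r x j := by ext k; simp [window]
  rw [h2] at h1
  exact (ENNReal.ofReal_le_ofReal_iff hδ.le).1 (h1.trans h.le)

theorem tendsto_action {S : (Fin (r + 1) → ℝ) → ℝ} (hS : Continuous S)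
    {T : ℕ → (Fin (r + 1) → ℝ) → ℝ} {K : ℝ} {δ : ℕ → ℝ} (hδ : Tendsto δ atTop (𝓝 0))
    (hT : ∀ n, c0Norm K (T n - S) < ENNReal.ofReal (δ n)) {x : ℕ → ℤ → ℝ} {y : ℤ → ℝ}
    (hx : ∀ n, x n ∈ boundedIncr K) (hxy : Tendsto x atTop (𝓝 y)) (i₀ i₁ : ℤ) :
    Tendsto (fun n => action (T n) i₀ i₁ (x n)) atTop (𝓝 (action S i₀ i₁ y)) := by
  refine tendsto_finsetSum _ fun j _ => ?_
  have h1 : Tendsto (fun n => S (window r (x n) j)) atTop (𝓝 (S (window r y j))) :=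
    (hS.tendsto _).comp (tendsto_pi_nhds.2 fun k => tendsto_pi_nhds.1 hxy _)
  have h2 : Tendsto (fun n => (T n - S) (window r (x n) j)) atTop (𝓝 0) :=
    squeeze_zero_norm (fun n => abs_window_le_of_c0Norm_lt (hT n) (hx n) j) hδ
  simpa using h2.add h1

/-- A minimality inequality against variations of size at most `1` passes to the limit: these
variations keep the sequences in `X_K`, where the potentials converge uniformly. -/
theorem action_le_action_add_of_tendsto {S : (Fin (r + 1) → ℝ) → ℝ} (hS : Continuous S)
    {T : ℕ → (Fin (r + 1) → ℝ) → ℝ} {K : ℝ} {δ : ℕ → ℝ} (hδ : Tendsto δ atTop (𝓝 0))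
    (hT : ∀ n, c0Norm (K + 2) (T n - S) < ENNReal.ofReal (δ n)) {x : ℕ → ℤ → ℝ} {y : ℤ → ℝ}
    (hx : ∀ n, x n ∈ boundedIncr K) (hxy : Tendsto x atTop (𝓝 y)) {i₀ i₁ : ℤ} {v : ℤ → ℝ}
    (hv : ∀ i, |v i| ≤ 1) (h : ∀ n, action (T n) i₀ i₁ (x n) ≤ action (T n) i₀ i₁ (x n + v)) :
    action S i₀ i₁ y ≤ action S i₀ i₁ (y + v) := by
  refine le_of_tendsto_of_tendsto'
    (tendsto_action hS hδ hT (fun n i => (hx n i).trans (by linarith)) hxy i₀ i₁)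
    (tendsto_action hS hδ hT (fun n i => ?_) (hxy.add_const v) i₀ i₁) h
  have h1 := abs_le.1 (hx n i)
  have h2 := abs_le.1 (hv i)
  have h3 := abs_le.1 (hv (i + 1))
  simp only [Pi.add_apply]
  rw [abs_le]; constructor <;> linarith

end Convergence

theorem mem_boundedIncr_of_abs_sub_le {x : ℤ → ℝ} {ω C : ℝ}
    (h : ∀ i : ℤ, |x i - (x 0 + ω * i)| ≤ C) : x ∈ boundedIncr (2 * C + |ω|) := by
  intro i
  have h1 := abs_le.1 (h i)
  have h2 := abs_le.1 (h (i + 1))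
  push_cast at h2
  have h3 := neg_abs_le ω
  have h4 := le_abs_self ω
  rw [abs_le]; constructor <;> linarith

/-! ### Robustness by compactness -/

/-- Let `M` assign a set of sequences to each potential. Suppose that, whenever `M T` is a
foliation, each initial value is attained in `M T` by a sequence within a fixed distance `C` of a
line of slope `ω`, and that limits of such sequences, along potentials converging to `S` on `X_K`,
lie in `M S`. Then being a lamination is a robust property of `M S`. -/
theorem exists_pos_not_isFoliation {r : ℕ} {S : (Fin (r + 1) → ℝ) → ℝ}
    (M : ((Fin (r + 1) → ℝ) → ℝ) → Set (ℤ → ℝ)) {ω C K : ℝ}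
    (hM : ∀ T, IsLocalPotential T → IsFoliation (M T) → ∀ ξ : ℝ, ∃ x ∈ M T, x 0 = ξ ∧
      ∀ i : ℤ, |x i - (x 0 + ω * i)| ≤ C)
    (hlim : ∀ (T : ℕ → (Fin (r + 1) → ℝ) → ℝ) (δ : ℕ → ℝ) (x : ℕ → ℤ → ℝ) (y : ℤ → ℝ),
      Tendsto δ atTop (𝓝 0) → (∀ n, c0Norm K (T n - S) < ENNReal.ofReal (δ n)) →
      (∀ n, x n ∈ M (T n)) → (∀ n, ∀ i : ℤ, |x n i - (x n 0 + ω * i)| ≤ C) →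
      Tendsto x atTop (𝓝 y) → y ∈ M S)
    (hS : ¬ IsFoliation (M S)) :
    ∃ δ : ℝ, 0 < δ ∧ ∀ T, IsLocalPotential T → c0Norm K (T - S) < ENNReal.ofReal δ →
      ¬ IsFoliation (M T) := by
  by_contra! H
  refine hS fun ξ => ?_
  choose T hT1 hT2 hT3 using fun n : ℕ => H (1 / ((n : ℝ) + 1)) (by positivity)
  choose x hxM hx0 hxC using fun n => hM (T n) (hT1 n) (hT3 n) ξ
  have hc : IsCompact (Set.univ.pi fun i : ℤ =>
      Set.Icc (ξ + ω * i - C) (ξ + ω * i + C)) := isCompact_univ_pi fun i => isCompact_Icc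
  obtain ⟨y, -, φ, hφ, hy⟩ := hc.tendsto_subseq (x := x) fun n i _ => by
    have := abs_le.1 (hxC n i)
    rw [hx0] at this
    constructor <;> linarith
  refine ⟨y, hlim (T ∘ φ) (fun n => 1 / ((φ n : ℝ) + 1)) (x ∘ φ) y
    (tendsto_one_div_add_atTop_nhds_zero_nat.comp hφ.tendsto_atTop) (fun n => hT2 (φ n))
    (fun n => hxM (φ n)) (fun n => hxC (φ n)) hy, ?_⟩
  refine tendsto_nhds_unique (tendsto_pi_nhds.1 hy 0) ?_
  simp [hx0]

/-! ### Limits of Birkhoff global minimizers -/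

theorem continuous_translate (k l : ℤ) : Continuous (translate k l) :=
  continuous_pi fun _ => (continuous_apply _).add continuous_const

theorem isBirkhoff_iff {x : ℤ → ℝ} : IsBirkhoff x ↔ ∀ k l k' l' : ℤ,
    translate k l x ≤ translate k' l' x ∨ translate k' l' x ≤ translate k l x := by
  constructor
  · intro h k l k' l'
    exact h.total ⟨k, l, rfl⟩ ⟨k', l', rfl⟩
  · rintro h _ ⟨k, l, rfl⟩ _ ⟨k', l', rfl⟩ -
    exact h k l k' l'

theorem isClosed_isBirkhoff : IsClosed {x : ℤ → ℝ | IsBirkhoff x} := by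
  simp only [isBirkhoff_iff, Set.ofPred_forall]
  exact isClosed_iInter fun k => isClosed_iInter fun l => isClosed_iInter fun k' =>
    isClosed_iInter fun l' =>
      (isClosed_le (continuous_translate k l) (continuous_translate k' l')).union
        (isClosed_le (continuous_translate k' l') (continuous_translate k l))

theorem isClosed_hasRotationNumber (ω : ℝ) : IsClosed {x : ℤ → ℝ | HasRotationNumber x ω} := by
  simp only [HasRotationNumber, Set.ofPred_forall]
  exact isClosed_iInter fun i => isClosed_le (by fun_prop) continuous_const

theorem mem_minimizers_of_tendsto {r : ℕ} {S : (Fin (r + 1) → ℝ) → ℝ}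
    (hS : IsLocalPotential S) {ω : ℝ} {T : ℕ → (Fin (r + 1) → ℝ) → ℝ} {δ : ℕ → ℝ}
    {x : ℕ → ℤ → ℝ} {y : ℤ → ℝ} (hδ : Tendsto δ atTop (𝓝 0))
    (hT : ∀ n, c0Norm (2 * 1 + |ω| + 2) (T n - S) < ENNReal.ofReal (δ n))
    (hx : ∀ n, x n ∈ minimizers (T n) ω) (hxy : Tendsto x atTop (𝓝 y)) :
    y ∈ minimizers S ω := by
  refine ⟨isClosed_isBirkhoff.mem_of_tendsto hxy (.of_forall fun n => (hx n).1),
    (isClosed_hasRotationNumber ω).mem_of_tendsto hxy (.of_forall fun n => (hx n).2.1),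
    fun i₀ i₁ v hv => ?_⟩
  have hfin : (Set.range fun i => |v i|).Finite := by
    refine (((Set.finite_Icc (i₀ + (r : ℤ)) i₁).image fun i => |v i|).insert 0).subset ?_
    rintro _ ⟨i, rfl⟩
    by_cases h : v i = 0
    · left; simp [h]
    · exact .inr ⟨i, hv h, rfl⟩
  obtain ⟨B, hB⟩ := hfin.bddAbove
  refine le_apply_add_of_bounded (hS.action_inf_add_sup_le i₀ i₁)
    (by simpa using hS.action_add_int i₀ i₁ 1)
    (V := {v | Function.support v ⊆ Set.Icc (i₀ + (r : ℤ)) i₁})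
    (fun v hv φ hφ i hi => hv fun h => hi (by simp only [h, hφ]))
    (fun v hv hv1 => action_le_action_add_of_tendsto hS.contDiff.continuous hδ hT
      (fun n => mem_boundedIncr_of_abs_sub_le (hx n).2.1) hxy hv1
      fun n => (hx n).2.2 i₀ i₁ v hv) ⌈B⌉₊ v hv fun i => ?_
  have := hB ⟨i, rfl⟩
  have := Nat.le_ceil B
  simp only at *
  linarith

/-! ### Periodic minimizers -/

section Periodic

variable {r : ℕ} {S : (Fin (r + 1) → ℝ) → ℝ} {p q : ℤ}

theorem mem_periodicSeq {x : ℤ → ℝ} : x ∈ periodicSeq p q ↔ ∀ i, x (i - p) + q = x i :=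
  funext_iff

theorem apply_sub_mul_of_mem_periodicSeq {x : ℤ → ℝ} (hx : x ∈ periodicSeq p q) (t i : ℤ) :
    x (i - t * p) = x i - t * q := by
  rw [mem_periodicSeq] at hx
  induction t using Int.induction_on generalizing i with
  | zero => simp
  | succ n ih =>
    have h1 := ih (i - p)
    have h2 := hx i
    rw [show i - ((n : ℤ) + 1) * p = i - p - n * p by ring, h1]
    push_cast; linarith
  | pred n ih =>
    have h1 := ih (i + p)
    have h2 := hx (i + p)
    rw [add_sub_cancel_right] at h2
    rw [show i - (-(n : ℤ) - 1) * p = i + p - (-n) * p by ring, h1]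
    push_cast; linarith

theorem inf_mem_periodicSeq {x y : ℤ → ℝ} (hx : x ∈ periodicSeq p q)
    (hy : y ∈ periodicSeq p q) : x ⊓ y ∈ periodicSeq p q := by
  rw [mem_periodicSeq] at *
  intro i
  simp only [Pi.inf_apply]
  rw [← hx i, ← hy i, min_add_add_right]

theorem sup_mem_periodicSeq {x y : ℤ → ℝ} (hx : x ∈ periodicSeq p q)
    (hy : y ∈ periodicSeq p q) : x ⊔ y ∈ periodicSeq p q := by
  rw [mem_periodicSeq] at *
  intro i
  simp only [Pi.sup_apply]
  rw [← hx i, ← hy i, max_add_add_right]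

theorem translate_mem_periodicSeq {x : ℤ → ℝ} (hx : x ∈ periodicSeq p q) (k l : ℤ) :
    translate k l x ∈ periodicSeq p q := by
  rw [mem_periodicSeq] at *
  intro i
  have := hx (i - k)
  simp only [translate]
  rw [← this, sub_right_comm]; ring

theorem exists_abs_le_of_mem_periodicSeq (hp : 0 < p) {v : ℤ → ℝ} (hv : v ∈ periodicSeq p 0) :
    ∃ B, ∀ i, |v i| ≤ B := by
  obtain ⟨B, hB⟩ := ((Set.finite_Icc (0 : ℤ) p).image fun i => |v i|).bddAbove
  refine ⟨B, fun i => hB ⟨i % p, ⟨Int.emod_nonneg _ hp.ne', (Int.emod_lt_of_pos _ hp).le⟩, ?_⟩⟩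
  have := apply_sub_mul_of_mem_periodicSeq hv (i / p) i
  have e : i - i / p * p = i % p := by rw [Int.emod_def]; ring
  rw [e] at this
  simp [this]

theorem sum_Icc_comp_sub {f : ℤ → ℝ} (hp : 0 < p) (hf : ∀ i, f (i - p) = f i) (k : ℤ) :
    ∑ j ∈ Finset.Icc 0 (p - 1), f (j - k) = ∑ j ∈ Finset.Icc 0 (p - 1), f j := by
  have one : ∀ g : ℤ → ℝ, (∀ i, g (i - p) = g i) →
      ∑ j ∈ Finset.Icc 0 (p - 1), g (j - 1) = ∑ j ∈ Finset.Icc 0 (p - 1), g j := by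
    intro g hg
    have e : ∑ j ∈ Finset.Icc 0 (p - 1), g (j - 1) = ∑ j ∈ Finset.Icc (-1) (p - 2), g j :=
      Finset.sum_bij (fun j _ => j - 1) (by simp; omega) (by simp) (fun b hb =>
        ⟨b + 1, by simp at hb ⊢; omega, by simp⟩) (by simp)
    have e1 : Finset.Icc (-1) (p - 2) = insert (-1) (Finset.Icc 0 (p - 2)) := by
      ext i; simp; omega
    have e2 : Finset.Icc 0 (p - 1) = insert (p - 1) (Finset.Icc 0 (p - 2)) := by
      ext i; simp; omega
    rw [e, e1, e2, Finset.sum_insert (by simp), Finset.sum_insert (by simp; omega), ← hg (p - 1)]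
    simp
  induction k using Int.induction_on with
  | zero => simp
  | succ n ih =>
    rw [← ih, ← one (fun j => f (j - n)) fun i => by rw [sub_right_comm, hf]]
    simp only [sub_sub, add_comm]
  | pred n ih =>
    rw [← ih, ← one (fun j => f (j - (-n - 1))) fun i => by rw [sub_right_comm, hf]]
    refine Finset.sum_congr rfl fun j _ => ?_
    congr 1; ring

theorem IsLocalPotential.action_translate (hS : IsLocalPotential S) (hp : 0 < p) {x : ℤ → ℝ}
    (hx : x ∈ periodicSeq p q) (k l : ℤ) :
    action S 0 (p - 1) (translate k l x) = action S 0 (p - 1) x := by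
  have hper : ∀ j, S (window r x (j - p)) = S (window r x j) := by
    intro j
    rw [← hS.apply_add_int q]
    congr 1; ext i
    simp only [window]
    rw [← mem_periodicSeq.1 hx (j + _)]
    ring_nf
  refine Eq.trans ?_ (sum_Icc_comp_sub hp hper k)
  refine Finset.sum_congr rfl fun j _ => ?_
  rw [← hS.apply_add_int l (window r x (j - k))]
  congr 1; ext i
  simp only [window, translate]
  ring_nf

theorem IsLocalPotential.inf_mem_periodicMinimizers (hS : IsLocalPotential S) {x y : ℤ → ℝ}
    (hx : x ∈ periodicMinimizers S p q) (hy : y ∈ periodicMinimizers S p q) :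
    x ⊓ y ∈ periodicMinimizers S p q := by
  refine ⟨inf_mem_periodicSeq hx.1 hy.1, fun z hz => ?_⟩
  have h1 := hS.action_inf_add_sup_le 0 (p - 1) x y
  have h2 := hy.2 _ (sup_mem_periodicSeq hx.1 hy.1)
  have h3 := hx.2 z hz
  linarith

theorem IsLocalPotential.sup_mem_periodicMinimizers (hS : IsLocalPotential S) {x y : ℤ → ℝ}
    (hx : x ∈ periodicMinimizers S p q) (hy : y ∈ periodicMinimizers S p q) :
    x ⊔ y ∈ periodicMinimizers S p q := by
  refine ⟨sup_mem_periodicSeq hx.1 hy.1, fun z hz => ?_⟩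
  have h1 := hS.action_inf_add_sup_le 0 (p - 1) x y
  have h2 := hy.2 _ (inf_mem_periodicSeq hx.1 hy.1)
  have h3 := hx.2 z hz
  linarith

theorem IsLocalPotential.translate_mem_periodicMinimizers (hS : IsLocalPotential S)
    (hp : 0 < p) {x : ℤ → ℝ} (hx : x ∈ periodicMinimizers S p q) (k l : ℤ) :
    translate k l x ∈ periodicMinimizers S p q :=
  ⟨translate_mem_periodicSeq hx.1 k l, by
    rw [hS.action_translate hp hx.1]; exact hx.2⟩

/-- The minimum of the translates `τ_{k,l} x` with `l ≥ kω` only involves finitely many `k` by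
periodicity, so it is again a periodic minimizer. As these `(k, l)` form a semigroup, it lies
below all of its own translates of this form, and therefore close to a line of slope `ω`. -/
theorem exists_mem_periodicMinimizers_abs_sub_le (hS : IsLocalPotential S) (hp : 0 < p) {ω : ℝ}
    (hω : ω = q / p) {x : ℤ → ℝ} (hx : x ∈ periodicMinimizers S p q) :
    ∃ z ∈ periodicMinimizers S p q, ∀ i : ℤ, |z i - (z 0 + ω * i)| ≤ 1 := by
  have hpω : ω * p = q := by
    rw [hω]; exact div_mul_cancel₀ _ (by exact_mod_cast hp.ne')
  have hne : (Finset.Ico 0 p).Nonempty := ⟨0, by simpa using hp⟩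
  set z : ℤ → ℝ := (Finset.Ico 0 p).inf' hne fun k => translate k ⌈k * ω⌉ x with hz
  have hzM : z ∈ periodicMinimizers S p q :=
    Finset.inf'_induction hne _ (fun a ha b hb => hS.inf_mem_periodicMinimizers ha hb)
      fun k _ => hS.translate_mem_periodicMinimizers hp hx k _
  have hz_le : ∀ k i : ℤ, z i ≤ x (i - k) + ⌈k * ω⌉ := by
    intro k i
    have h1 : z ≤ translate (k % p) ⌈((k % p : ℤ) : ℝ) * ω⌉ x :=
      Finset.inf'_le (fun k : ℤ => translate k ⌈k * ω⌉ x)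
        (Finset.mem_Ico.2 ⟨Int.emod_nonneg _ hp.ne', Int.emod_lt_of_pos _ hp⟩)
    refine (h1 i).trans_eq ?_
    have h2 := apply_sub_mul_of_mem_periodicSeq hx.1 (k / p) (i - k % p)
    have e1 : i - k % p - k / p * p = i - k := by
      rw [Int.emod_def]; ring
    have e2 : (k : ℝ) * ω = ((k % p : ℤ) : ℝ) * ω + ((k / p * q : ℤ) : ℝ) := by
      have : (k : ℝ) = ((k % p : ℤ) : ℝ) + ((k / p : ℤ) : ℝ) * p := by
        rw [Int.emod_def]; push_cast; ring
      rw [Int.cast_mul, ← hpω]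
      linear_combination ω * this
    rw [e1] at h2
    rw [e2, Int.ceil_add_intCast, h2]
    simp only [translate]
    push_cast; ring
  have hz_sub : ∀ k i : ℤ, z i ≤ z (i - k) + ⌈k * ω⌉ := by
    intro k i
    obtain ⟨m, -, hm⟩ := Finset.exists_mem_eq_inf' hne fun m : ℤ =>
      translate m ⌈m * ω⌉ x (i - k)
    have h1 : z (i - k) = x (i - k - m) + ⌈m * ω⌉ := by
      rw [hz, Finset.inf'_apply, hm]; rfl
    have h2 := hz_le (k + m) i
    have h3 : ((⌈((k + m : ℤ) : ℝ) * ω⌉ : ℤ) : ℝ) ≤ ⌈k * ω⌉ + ⌈m * ω⌉ := by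
      push_cast
      rw [add_mul]
      exact_mod_cast Int.ceil_add_le _ _
    rw [← sub_sub] at h2
    linarith
  refine ⟨z, hzM, fun i => ?_⟩
  have h1 := hz_sub i i
  have h2 := hz_sub (-i) 0
  have h3 := Int.ceil_lt_add_one ((i : ℝ) * ω)
  have h4 := Int.ceil_lt_add_one (((-i : ℤ) : ℝ) * ω)
  simp only [sub_self, sub_neg_eq_add, zero_add] at h1 h2
  push_cast at h2 h4
  rw [abs_le]; constructor <;> linarith

theorem exists_mem_periodicMinimizers_apply_zero (hS : IsLocalPotential S) (hp : 0 < p) {ω : ℝ}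
    (hω : ω = q / p) {x : ℤ → ℝ} (hx : x ∈ periodicMinimizers S p q) :
    ∃ w ∈ periodicMinimizers S p q, w 0 = x 0 ∧ ∀ i : ℤ, |w i - (w 0 + ω * i)| ≤ 2 := by
  obtain ⟨z, hz, hzω⟩ := exists_mem_periodicMinimizers_abs_sub_le hS hp hω hx
  -- clamp `x` between two consecutive integer shifts of `z` whose values at `0` enclose `x 0`
  set b : ℤ := ⌈x 0 - z 0⌉ with hb
  have hb1 := Int.ceil_lt_add_one (x 0 - z 0)
  have hb2 := Int.le_ceil (x 0 - z 0)
  rw [← hb] at hb1 hb2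
  have hw0 : (translate 0 (b - 1) z ⊔ (translate 0 b z ⊓ x)) 0 = x 0 := by
    simp only [Pi.sup_apply, Pi.inf_apply, translate, sub_zero]
    push_cast
    rw [min_eq_right (by linarith), max_eq_right (by linarith)]
  refine ⟨translate 0 (b - 1) z ⊔ (translate 0 b z ⊓ x),
    hS.sup_mem_periodicMinimizers (hS.translate_mem_periodicMinimizers hp hz _ _)
      (hS.inf_mem_periodicMinimizers (hS.translate_mem_periodicMinimizers hp hz _ _) hx),
    hw0, fun i => ?_⟩
  rw [hw0]
  simp only [Pi.sup_apply, Pi.inf_apply, translate, sub_zero]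
  push_cast
  have h := abs_le.1 (hzω i)
  rw [abs_le]; constructor
  · have := le_max_left (z i + ((b : ℝ) - 1)) (min (z i + b) (x i))
    linarith
  · have : max (z i + ((b : ℝ) - 1)) (min (z i + b) (x i)) ≤ z i + b :=
      max_le (by linarith) (min_le_left _ _)
    linarith

theorem mem_periodicMinimizers_of_tendsto (hS : IsLocalPotential S) (hp : 0 < p) {ω C : ℝ}
    {T : ℕ → (Fin (r + 1) → ℝ) → ℝ} {δ : ℕ → ℝ} {x : ℕ → ℤ → ℝ} {y : ℤ → ℝ}
    (hδ : Tendsto δ atTop (𝓝 0))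
    (hT : ∀ n, c0Norm (2 * C + |ω| + 2) (T n - S) < ENNReal.ofReal (δ n))
    (hx : ∀ n, x n ∈ periodicMinimizers (T n) p q)
    (hxω : ∀ n, ∀ i : ℤ, |x n i - (x n 0 + ω * i)| ≤ C) (hxy : Tendsto x atTop (𝓝 y)) :
    y ∈ periodicMinimizers S p q := by
  have hy : y ∈ periodicSeq p q :=
    (isClosed_eq (continuous_translate p q) continuous_id).mem_of_tendsto hxy
      (.of_forall fun n => (hx n).1)
  refine ⟨hy, fun u hu => ?_⟩
  have hv : u - y ∈ periodicSeq p 0 := mem_periodicSeq.2 fun i => by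
    have h1 := mem_periodicSeq.1 hu i
    have h2 := mem_periodicSeq.1 hy i
    simp only [Pi.sub_apply]
    push_cast; linarith
  obtain ⟨B, hB⟩ := exists_abs_le_of_mem_periodicSeq hp hv
  rw [← add_sub_cancel y u]
  refine le_apply_add_of_bounded (hS.action_inf_add_sup_le 0 (p - 1))
    (by simpa using hS.action_add_int 0 (p - 1) 1) (V := periodicSeq p 0)
    (fun v hv φ _ => mem_periodicSeq.2 fun i => ?_)
    (fun v hv hv1 => action_le_action_add_of_tendsto hS.contDiff.continuous hδ hT
      (fun n => mem_boundedIncr_of_abs_sub_le (hxω n)) hxy hv1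
      fun n => (hx n).2 _ (mem_periodicSeq.2 fun i => ?_)) ⌈B⌉₊ _ hv fun i => ?_
  · rw [← mem_periodicSeq.1 hv i]; simp
  · have h1 := mem_periodicSeq.1 (hx n).1 i
    have h2 := mem_periodicSeq.1 hv i
    simp only [Pi.add_apply]
    push_cast at h2; linarith
  · have h1 := hB i
    have h2 := Nat.le_ceil B
    linarith

end Periodic

end AubryMather

theorem theorem5p2 (r : ℕ) (hr : 1 ≤ r) (ω : ℝ) (S : (Fin (r + 1) → ℝ) → ℝ)
    (hS : AubryMather.IsLocalPotential S) :
    -- robustness for Birkhoff global minimizers of rotation number `ω`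
    (¬ AubryMather.IsFoliation (AubryMather.minimizers S ω) →
      ∃ δ : ℝ, 0 < δ ∧ ∃ K : ℝ, 0 < K ∧
        ∀ S' : (Fin (r + 1) → ℝ) → ℝ, AubryMather.IsLocalPotential S' →
          AubryMather.c0Norm K (S' - S) < ENNReal.ofReal δ →
          AubryMather.c1Norm K (S' - S) ≤ 1 →
          ¬ AubryMather.IsFoliation (AubryMather.minimizers S' ω)) ∧
    -- robustness for periodic minimizers, when `ω = q / p` is rational
    (∀ p q : ℤ, 0 < p → ω = (q : ℝ) / (p : ℝ) →
      ¬ AubryMather.IsFoliation (AubryMather.periodicMinimizers S p q) →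
      ∃ δ : ℝ, 0 < δ ∧ ∃ K : ℝ, 0 < K ∧
        ∀ S' : (Fin (r + 1) → ℝ) → ℝ, AubryMather.IsLocalPotential S' →
          AubryMather.c0Norm K (S' - S) < ENNReal.ofReal δ →
          AubryMather.c1Norm K (S' - S) ≤ 1 →
          ¬ AubryMather.IsFoliation (AubryMather.periodicMinimizers S' p q)) ∧
    -- for irrational `ω`, having a lamination is an open property in the `C^1` sense
    (Irrational ω → ¬ AubryMather.IsFoliation (AubryMather.minimizers S ω) →
      ∃ η : ℝ, 0 < η ∧ ∃ K : ℝ, 0 < K ∧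
        ∀ S' : (Fin (r + 1) → ℝ) → ℝ, AubryMather.IsLocalPotential S' →
          AubryMather.c1Norm K (S' - S) < ENNReal.ofReal η →
          ¬ AubryMather.IsFoliation (AubryMather.minimizers S' ω)) := by
  open AubryMather in
  have robust : ¬ IsFoliation (minimizers S ω) → ∃ δ : ℝ, 0 < δ ∧ ∀ T, IsLocalPotential T →
      c0Norm (2 * 1 + |ω| + 2) (T - S) < ENNReal.ofReal δ →
      ¬ IsFoliation (minimizers T ω) :=
    exists_pos_not_isFoliation (fun T => minimizers T ω) (ω := ω) (C := 1)
      (fun T _ h ξ => by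
        obtain ⟨x, hx, hx0⟩ := h ξ
        exact ⟨x, hx, hx0, hx.2.1⟩)
      (fun T δ x y hδ hT hx _ hxy => mem_minimizers_of_tendsto hS hδ hT hx hxy)
  refine ⟨fun h => ?_, fun p q hp hω h => ?_, fun _ h => ?_⟩
  · obtain ⟨δ, hδ, H⟩ := robust h
    exact ⟨δ, hδ, _, by positivity, fun T hT h0 _ => H T hT h0⟩
  · obtain ⟨δ, hδ, H⟩ := AubryMather.exists_pos_not_isFoliation
      (fun T => AubryMather.periodicMinimizers T p q) (ω := ω) (C := 2)
      (fun T hT h ξ => by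
        obtain ⟨x, hx, rfl⟩ := h ξ
        exact AubryMather.exists_mem_periodicMinimizers_apply_zero hT hp hω hx)
      (fun T δ x y hδ hT hx hxω hxy =>
        AubryMather.mem_periodicMinimizers_of_tendsto hS hp hδ hT hx hxω hxy) h
    exact ⟨δ, hδ, _, by positivity, fun T hT h0 _ => H T hT h0⟩
  · obtain ⟨δ, hδ, H⟩ := robust h
    exact ⟨δ, hδ, _, by positivity, fun T hT h1 => H T hT ((le_max_left _ _).trans_lt h1)⟩
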